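/- Let $k$ be a field and $\Lambda=k[p]$ the polynomial algebra in one variable. A partition $\alpha=(\alpha_1\ge\dots\ge\alpha_n)$ is identified with the Young diagram having columns of lengths $\alpha_1,\dots,\alpha_n$ (top-aligned), $\overline{\alpha}$ is the transposed partition, and $N_\alpha=\bigoplus_i\Lambda/(p^{\alpha_i})$. Let $\mathcal S(\Lambda)$ be the category of embeddings $(A\subset B)$, where $B$ is a finite-dimensional $\Lambda$-module on which $p$ acts nilpotently and $A$ is a submodule; morphisms $(A\subset B)\to(A'\subset B')$ are the $\Lambda$-homomorphisms $B\to B'$ mapping $A$ into $A'$, and a sequence $0\to U\to H\to V\to 0$ in $\mathcal S(\Lambda)$ is exact if it is exact on the modules $B$ and on the submodules $A$. Let $\gamma\subseteq\beta$ be partitions. An LR-tableau of shape $\beta\setminus\gamma$ is a filling of the cells of $\beta\setminus\gamma$ with positive integers that is weakly increasing along rows, strictly increasing down columns, and such that for all $e\ge1$ and every column $c$ the columns from $c$ on to the right contain at least as many entries $e$ as entries $e+1$. It is identified with the sequence $\gamma=\gamma^{(0)}\subseteq\gamma^{(1)}\subseteq\dots\subseteq\beta$, eventually equal to $\beta$,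 where $\gamma^{(e)}$ consists of $\gamma$ and all cells with entry at most $e$. An embedding $X=(A\subset B)$ has LR-tableau $LR(X)=[\gamma^{(0)},\gamma^{(1)},\dots]$ if $B/p^eA\cong N_{\gamma^{(e)}}$ for all $e\ge0$. The skew diagram $\beta\setminus\gamma$ is a rook strip if $\beta_i\le\gamma_i+1$ and $\overline{\beta}_i\le\overline{\gamma}_i+1$ for all $i$, i.e. if it has at most one cell in each column and in each row. For embeddings $X,Y$ write $X\le_{\sf ext}Y$ if there are embeddings $H_1,\dots,H_{s+1}$ with $X\cong H_1$, $Y\cong H_{s+1}$, and short exact sequences $0\to U_i\to H_i\to V_i\to0$ in $\mathcal S(\Lambda)$ with $U_i\oplus V_i\cong H_{i+1}$ for $1\le i\le s$. For LR-tableaux $\Gamma,\widetilde\Gamma$ of shape $\beta\setminus\gamma$ write $\Gamma\le_{\sf ext}\widetilde\Gamma$ if there is a sequence $\Gamma=\Gamma^{(0)},\dots,\Gamma^{(s)}=\widetilde\Gamma$ of LR-tableaux of shape $\beta\setminus\gamma$ such that for each $1\le i\le s$ there are embeddings $X=(A\subset B)$, $Y=(A'\subset B')$ with $B\cong B'\cong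 N_\beta$, $B/A\cong B'/A'\cong N_\gamma$, $LR(X)=\Gamma^{(i-1)}$, $LR(Y)=\Gamma^{(i)}$ and $X\le_{\sf ext}Y$. **Proposition.** Let $\beta\setminus\gamma$ be a rook strip and let $\Delta,\Gamma$ be LR-tableaux of shape $\beta\setminus\gamma$ such that $\Delta$ is obtained from $\Gamma$ by increasing one entry. Then $\Delta\le_{\sf ext}\Gamma$. -/

import Mathlib

open Polynomial

universe u

namespace RookStrip

/-! ### Skew diagrams and Littlewood–Richardson tableaux

Partitions are Young diagrams.  The parts of the partition `α` are the lengths of the *columns*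
of its diagram, i.e. `α_{j+1} = α.colLen j`.  A cell is `(row, column)`, rows are numbered from
top to bottom and columns from left to right, both starting with `0`. -/

/-- The skew diagram `β \ γ` is a rook strip: it has at most one cell in each column
(`β_j ≤ γ_j + 1`) and at most one cell in each row (the same for the transposed partitions). -/
def IsRookStrip (β γ : YoungDiagram) : Prop :=
  γ ≤ β ∧ (∀ j, β.colLen j ≤ γ.colLen j + 1) ∧ (∀ i, β.rowLen i ≤ γ.rowLen i + 1)

/-- Littlewood–Richardson tableaux of shape `β \ γ` (and of arbitrary content).
The function `entry` gives the (positive) entries on `β \ γ` and is set to be `0` elsewhere.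
In the field `lattice`, the case `c = 0` says that the number of entries `e` is weakly decreasing
in `e ≥ 1`, i.e. that the content of the tableau is a partition. -/
@[ext]
structure LRTableau (β γ : YoungDiagram) where
  le : γ ≤ β
  entry : ℕ → ℕ → ℕ
  pos : ∀ i j, (i, j) ∈ β → (i, j) ∉ γ → 1 ≤ entry i j
  zero : ∀ i j, ((i, j) ∉ β ∨ (i, j) ∈ γ) → entry i j = 0
  row_weak : ∀ i j₁ j₂, j₁ < j₂ → (i, j₁) ∉ γ → (i, j₂) ∈ β → entry i j₁ ≤ entry i j₂
  col_strict : ∀ i₁ i₂ j, i₁ < i₂ → (i₁, j) ∉ γ → (i₂, j) ∈ β → entry i₁ j < entry i₂ j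
  lattice : ∀ c e, 1 ≤ e →
    (β.cells.filter fun x => c ≤ x.2 ∧ entry x.1 x.2 = e + 1).card ≤
      (β.cells.filter fun x => c ≤ x.2 ∧ entry x.1 x.2 = e).card

theorem LRTableau.entry_mono {β γ : YoungDiagram} (Γ : LRTableau β γ) {i₁ i₂ j₁ j₂ : ℕ}
    (hi : i₁ ≤ i₂) (hj : j₁ ≤ j₂) (h : (i₂, j₂) ∈ β) : Γ.entry i₁ j₁ ≤ Γ.entry i₂ j₂ := by
  by_cases h1 : (i₁, j₁) ∈ γ
  · simp [Γ.zero i₁ j₁ (Or.inr h1)]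
  have h2 : (i₁, j₂) ∈ β := β.up_left_mem hi le_rfl h
  have h3 : (i₁, j₂) ∉ γ := fun hc => h1 (γ.up_left_mem le_rfl hj hc)
  calc Γ.entry i₁ j₁ ≤ Γ.entry i₁ j₂ := by
        rcases hj.eq_or_lt with rfl | hlt
        · exact le_rfl
        · exact Γ.row_weak i₁ j₁ j₂ hlt h1 h2
    _ ≤ Γ.entry i₂ j₂ := by
        rcases hi.eq_or_lt with rfl | hlt
        · exact le_rfl
        · exact (Γ.col_strict i₁ i₂ j₂ hlt h3 h).le

/-- The partition `γ^(e)`: the diagram formed by `γ` and all cells with entry at most `e`.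
The tableau `Γ` is identified with the sequence `γ = γ^(0) ⊆ γ^(1) ⊆ … ⊆ β`, which is
eventually constant with value `β`. -/
def LRTableau.stage {β γ : YoungDiagram} (Γ : LRTableau β γ) (e : ℕ) : YoungDiagram where
  cells := β.cells.filter fun x => Γ.entry x.1 x.2 ≤ e
  isLowerSet := by
    rintro ⟨i₂, j₂⟩ ⟨i₁, j₁⟩ ⟨hi, hj⟩ h
    simp only [Finset.coe_filter, Set.mem_ofPred_eq, YoungDiagram.mem_cells] at h ⊢
    exact ⟨β.up_left_mem hi hj h.1, (Γ.entry_mono hi hj h.1).trans h.2⟩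

/-- `Δ` is obtained from `Γ` by increasing one entry. -/
def LRTableau.IncreasesEntry {β γ : YoungDiagram} (Δ Γ : LRTableau β γ) : Prop :=
  ∃ i j, (i, j) ∈ β ∧ (i, j) ∉ γ ∧ Γ.entry i j < Δ.entry i j ∧
    ∀ i' j', (i', j') ≠ (i, j) → Δ.entry i' j' = Γ.entry i' j'

/-! ### Invariant subspaces of nilpotent linear operators

The variable `p` of the polynomial algebra `Λ = k[p]` is `Polynomial.X`. -/

/-- `N_α = ⨁_j Λ/(p^{α_j})`, the sum taken over the columns of the diagram `α`. -/
abbrev N (k : Type u) [Field k] (α : YoungDiagram) : Type u :=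
  (j : Fin (α.rowLen 0)) → k[X] ⧸ Ideal.span {(X : k[X]) ^ α.colLen j}

/-- The objects `(A ⊂ B)` of `S(Λ)`: `B` is a finitely generated `Λ`-module on which `p` acts
nilpotently (equivalently, a nilpotent linear operator on a finite dimensional `k`-space), and
`A` is a submodule of `B`. -/
structure Emb (k : Type u) [Field k] : Type (u + 1) where
  B : Type u
  [addCommGroup : AddCommGroup B]
  [module : Module k[X] B]
  [finite : Module.Finite k[X] B]
  nilpotent : ∃ n : ℕ, ∀ b : B, (X : k[X]) ^ n • b = 0
  A : Submodule k[X] B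

attribute [instance] Emb.addCommGroup Emb.module Emb.finite

namespace Emb

variable {k : Type u} [Field k]

/-- Morphisms `(A ⊂ B) → (A' ⊂ B')`: `Λ`-linear maps `B → B'` carrying `A` into `A'`. -/
structure Hom (U V : Emb k) where
  toLin : U.B →ₗ[k[X]] V.B
  maps : ∀ a ∈ U.A, toLin a ∈ V.A

/-- The map `A → A'` induced by a morphism `(A ⊂ B) → (A' ⊂ B')`. -/
noncomputable def Hom.sub {U V : Emb k} (f : Hom U V) : U.A →ₗ[k[X]] V.A :=
  f.toLin.restrict f.maps

/-- The sequence `0 → U → H → V → 0` is exact in `S(Λ)`: both the sequence of the modules `B`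
and the sequence of the submodules `A` are exact. -/
def IsShortExact {U H V : Emb k} (f : Hom U H) (g : Hom H V) : Prop :=
  (Function.Injective f.toLin ∧ Function.Exact f.toLin g.toLin ∧ Function.Surjective g.toLin) ∧
  (Function.Injective f.sub ∧ Function.Exact f.sub g.sub ∧ Function.Surjective g.sub)

/-- Isomorphism of objects of `S(Λ)`. -/
def IsIso (U V : Emb k) : Prop :=
  ∃ φ : U.B ≃ₗ[k[X]] V.B, ∀ b, b ∈ U.A ↔ φ b ∈ V.A

/-- The direct sum of two objects of `S(Λ)`. -/
noncomputable def directSum (U V : Emb k) : Emb k where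
  B := U.B × V.B
  nilpotent := by
    obtain ⟨m, hm⟩ := U.nilpotent
    obtain ⟨n, hn⟩ := V.nilpotent
    refine ⟨m + n, fun b => Prod.ext ?_ ?_⟩
    · rw [Prod.smul_fst, add_comm, pow_add, mul_smul, hm, smul_zero, Prod.fst_zero]
    · rw [Prod.smul_snd, pow_add, mul_smul, hn, smul_zero, Prod.snd_zero]
  A := U.A.prod V.A

/-- The relation `U ≤_ext V` between objects of `S(Λ)`: there are objects `H_0, …, H_s` with
`U ≅ H_0`, `V ≅ H_s`, and for all `i < s` a short exact sequence `0 → U_i → H_i → V_i → 0` with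
`U_i ⊕ V_i ≅ H_{i+1}`. -/
def ExtLE (U V : Emb k) : Prop :=
  ∃ (s : ℕ) (H : ℕ → Emb k), IsIso U (H 0) ∧ IsIso V (H s) ∧
    ∀ i < s, ∃ (U' V' : Emb k) (f : Hom U' (H i)) (g : Hom (H i) V'),
      IsShortExact f g ∧ IsIso (directSum U' V') (H (i + 1))

/-- The submodule `p^e A` of `B`. -/
noncomputable def powA (U : Emb k) (e : ℕ) : Submodule k[X] U.B :=
  U.A.map (LinearMap.lsmul k[X] U.B ((X : k[X]) ^ e))

/-- `(A ⊂ B)` belongs to `S_{r,γ}^β`, where `r = |β| - |γ|`: `B ≅ N_β` and `B/A ≅ N_γ`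
(then `A` has dimension `r`). -/
def HasType (U : Emb k) (β γ : YoungDiagram) : Prop :=
  Nonempty (U.B ≃ₗ[k[X]] N k β) ∧ Nonempty ((U.B ⧸ U.A) ≃ₗ[k[X]] N k γ)

/-- `LR(A ⊂ B) = Γ`: the partition `γ^(e)` of `Γ` is the isomorphism type of `B/p^e A`,
for all `e`. -/
def HasTableau (U : Emb k) {β γ : YoungDiagram} (Γ : LRTableau β γ) : Prop :=
  ∀ e : ℕ, Nonempty ((U.B ⧸ U.powA e) ≃ₗ[k[X]] N k (Γ.stage e))

end Emb

/-- The relation `Γ ≤_ext Γ'` on the Littlewood–Richardson tableaux of shape `β \ γ`, with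
respect to the field `k`: there is a sequence `Γ = Γ^(0), …, Γ^(s) = Γ'` of tableaux such that
for all `i < s` there are `U, V` in `S_{r,γ}^β` with tableaux `Γ^(i)` and `Γ^(i+1)`,
respectively, and `U ≤_ext V`. -/
def LRTableau.ExtLE (k : Type u) [Field k] {β γ : YoungDiagram} (Γ Γ' : LRTableau β γ) : Prop :=
  ∃ (s : ℕ) (G : ℕ → LRTableau β γ), G 0 = Γ ∧ G s = Γ' ∧
    ∀ i < s, ∃ U V : Emb k, U.HasType β γ ∧ V.HasType β γ ∧
      U.HasTableau (G i) ∧ V.HasTableau (G (i + 1)) ∧ Emb.ExtLE U V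

end RookStrip

/-!
On a rook strip each column of a tableau has at most one entry, and by the lattice property and
Hall's theorem each column with entry `e + 1` can be linked to a shorter column with entry `e`, with
distinct columns linked to distinct ones. The links to `i` give the relation that, modulo
`X ^ (b i - 1)`, the `i`-th coordinate is the sum of `X ^ (b i - b j - 1)` times the `j`-th ones,
where `b i` is the length of the column `i`. For the columns without entry, the coordinate is to
vanish. These relations cut out a submodule `A` of `N_β` realizing the tableau: `X ^ e • A` is cut
out by the relations at the columns with entry greater than `e` and the vanishing of the other
coordinates.

If `Δ` increases the entry of the column `m` of `Γ`, the links for `Γ` can be chosen such that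
neither `m` nor some shorter column `l`, whose entry is one less than that of `m` in `Δ`, is linked
to a longer column. Then `Δ` is realized by adding the link from `l` to `m`, and the columns
connected to `m` for `Γ` span a subobject: the direct sum of this subobject and its factor object
is the embedding without the additional link.
-/

namespace RookStrip

namespace Emb

variable {k : Type u} [Field k]

/-- The subobject `(A ∩ W ⊂ W)` of `(A ⊂ B)`. -/
noncomputable def restrict (E : Emb k) (W : Submodule k[X] E.B) : Emb k where
  B := W
  nilpotent := E.nilpotent.imp fun _ h w => Subtype.ext (h w)
  A := E.A.comap W.subtype

/-- The factor object `((A + W)/W ⊂ B/W)` of `(A ⊂ B)`. -/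
noncomputable def quotient (E : Emb k) (W : Submodule k[X] E.B) : Emb k where
  B := E.B ⧸ W
  nilpotent := E.nilpotent.imp fun _ h y => by
    obtain ⟨y, rfl⟩ := W.mkQ_surjective y
    rw [← map_smul, h, map_zero]
  A := E.A.map W.mkQ

/-- The inclusion `(A ∩ W ⊂ W) → (A ⊂ B)`. -/
noncomputable def restrictHom (E : Emb k) (W : Submodule k[X] E.B) : Hom (E.restrict W) E where
  toLin := W.subtype
  maps _ h := h

/-- The projection `(A ⊂ B) → ((A + W)/W ⊂ B/W)`. -/
noncomputable def quotientHom (E : Emb k) (W : Submodule k[X] E.B) : Hom E (E.quotient W) where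
  toLin := W.mkQ
  maps a h := ⟨a, h, rfl⟩

theorem isShortExact_restrict_quotient (E : Emb k) (W : Submodule k[X] E.B) :
    IsShortExact (E.restrictHom W) (E.quotientHom W) := by
  have hmk : ∀ y : E.B, W.mkQ y = 0 ↔ y ∈ W := fun y => Submodule.Quotient.mk_eq_zero W
  refine ⟨⟨W.subtype_injective, fun y => ?_, W.mkQ_surjective⟩,
    fun x y h => Subtype.ext (W.subtype_injective (congrArg (fun z : E.A => z.1) h)),
    fun y => ?_, ?_⟩
  · exact (hmk y).trans ⟨fun h => ⟨⟨y, h⟩, rfl⟩, fun ⟨w, hw⟩ => hw ▸ w.2⟩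
  · constructor
    · exact fun h => ⟨⟨⟨y.1, (hmk y.1).1 (congrArg Subtype.val h)⟩, y.2⟩, rfl⟩
    · rintro ⟨w, rfl⟩
      exact Subtype.ext ((hmk _).2 w.1.2)
  · rintro ⟨_, y, hy, rfl⟩
    exact ⟨⟨y, hy⟩, rfl⟩

theorem isIso_refl (U : Emb k) : IsIso U U :=
  ⟨LinearEquiv.refl _ _, fun _ => Iff.rfl⟩

theorem extLE_of_isShortExact {U H V E : Emb k} {f : Hom U H} {g : Hom H V}
    (hfg : IsShortExact f g) (hE : IsIso (directSum U V) E) : ExtLE H E :=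
  ⟨1, fun i => if i = 0 then H else E, isIso_refl H, isIso_refl E, fun i hi => by
    obtain rfl : i = 0 := Nat.lt_one_iff.1 hi
    exact ⟨U, V, f, g, hfg, hE⟩⟩

/-- The object `(A' ⊂ B)` obtained from `(A ⊂ B)` by changing the submodule. -/
noncomputable def withSub (E : Emb k) (A' : Submodule k[X] E.B) : Emb k where
  B := E.B
  nilpotent := E.nilpotent
  A := A'

theorem isIso_directSum_restrict_quotient (E : Emb k) {W : Submodule k[X] E.B}
    {P : E.B →ₗ[k[X]] E.B} (hP : LinearMap.IsProj W P) :
    IsIso (directSum (E.restrict W) (E.quotient W))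
      (E.withSub (E.A.comap P ⊓ (W ⊔ E.A))) := by
  -- `P` splits `W → B → B/W`: the isomorphism is inverse to `y ↦ (P y, y + W)`.
  have hbij : Function.Bijective (hP.codRestrict.prod W.mkQ) := by
    constructor
    · refine (injective_iff_map_eq_zero _).2 fun y hy => ?_
      have hW : y ∈ W := (Submodule.Quotient.mk_eq_zero W).1 (congrArg Prod.snd hy)
      exact (hP.map_id y hW).symm.trans (congrArg (fun z => (z.1 : E.B)) hy)
    · rintro ⟨w, q⟩
      obtain ⟨z, rfl⟩ := W.mkQ_surjective q
      refine ⟨w + (z - P z), Prod.ext (Subtype.ext ?_) ?_⟩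
      · change P (w + (z - P z)) = w
        rw [map_add, map_sub, hP.map_id w w.2, hP.map_id _ (hP.map_mem z), sub_self, add_zero]
      · refine (Submodule.Quotient.eq W).2 ?_
        rw [show (w : E.B) + (z - P z) - z = w - P z by abel]
        exact W.sub_mem w.2 (hP.map_mem z)
  let φ := LinearEquiv.ofBijective _ hbij
  have hmem : ∀ z : W × (E.B ⧸ W), z ∈ (E.A.comap W.subtype).prod (E.A.map W.mkQ) ↔
      φ.symm z ∈ E.A.comap P ⊓ (W ⊔ E.A) := fun z => by
    obtain ⟨y, rfl⟩ := φ.surjective z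
    rw [φ.symm_apply_apply, ← W.comap_map_mkQ]
    rfl
  exact ⟨φ.symm, hmem⟩

theorem extLE_withSub (E : Emb k) {W : Submodule k[X] E.B} {P : E.B →ₗ[k[X]] E.B}
    (hP : LinearMap.IsProj W P) {A' : Submodule k[X] E.B} (hA' : E.A.comap P ⊓ (W ⊔ E.A) = A') :
    ExtLE E (E.withSub A') :=
  hA' ▸ extLE_of_isShortExact (E.isShortExact_restrict_quotient W)
    (E.isIso_directSum_restrict_quotient hP)

end Emb

section TruncPoly

variable {R : Type*} [CommRing R] {κ : Type*}

/-- The cyclic module `R[X]/(X^n)`, a summand of `N_α` for `n` a part of `α`. -/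
abbrev TruncPoly (R : Type*) [CommRing R] (n : ℕ) : Type _ :=
  R[X] ⧸ Ideal.span {(X : R[X]) ^ n}

/-- The coordinatewise projection of a free module onto a product of truncated polynomial
modules; elements of the product are handled through their polynomial representatives. -/
noncomputable def mkPi (b : κ → ℕ) : (κ → R[X]) →ₗ[R[X]] ∀ i, TruncPoly R (b i) :=
  LinearMap.piMap fun i => (Ideal.span {(X : R[X]) ^ b i}).mkQ

theorem mkPi_apply_eq_zero {b : κ → ℕ} {f : κ → R[X]} {i : κ} :
    mkPi b f i = 0 ↔ X ^ b i ∣ f i :=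
  Ideal.Quotient.eq_zero_iff_dvd _ _

theorem mem_ker_mkPi {b : κ → ℕ} {f : κ → R[X]} :
    f ∈ LinearMap.ker (mkPi b) ↔ ∀ i, X ^ b i ∣ f i := by
  simp only [LinearMap.mem_ker, funext_iff, mkPi_apply_eq_zero, Pi.zero_apply]

theorem mkPi_surjective (b : κ → ℕ) : Function.Surjective (mkPi (R := R) b) :=
  Function.Surjective.piMap fun _ => Submodule.mkQ_surjective _

theorem mkPi_eq_mkPi {b : κ → ℕ} {f g : κ → R[X]} :
    mkPi b f = mkPi b g ↔ ∀ i, X ^ b i ∣ f i - g i := by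
  rw [← sub_eq_zero, ← map_sub]
  exact mem_ker_mkPi

open Classical in
/-- The projection of `∏ R[X]/(X^(b_i))` onto the factors with index in `S`. -/
noncomputable def coordProj (R : Type*) [CommRing R] (b : κ → ℕ) (S : Set κ) :
    (∀ i, TruncPoly R (b i)) →ₗ[R[X]] ∀ i, TruncPoly R (b i) :=
  LinearMap.piMap fun i => if i ∈ S then LinearMap.id else 0

theorem coordProj_mkPi {b : κ → ℕ} {S : Set κ} {f : κ → R[X]} :
    coordProj R b S (mkPi b f) = mkPi b (S.indicator f) := by
  ext1 i
  by_cases h : i ∈ S <;> simp [coordProj, mkPi, h]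

theorem isProj_coordProj (b : κ → ℕ) (S : Set κ) :
    LinearMap.IsProj (LinearMap.range (coordProj R b S)) (coordProj R b S) := by
  refine (LinearMap.isProj_range_iff_isIdempotentElem _).2 (LinearMap.ext fun y => ?_)
  obtain ⟨f, rfl⟩ := mkPi_surjective b y
  rw [Module.End.mul_apply, coordProj_mkPi, coordProj_mkPi, Set.indicator_indicator, Set.inter_self]

end TruncPoly

/-- Links between the columns of lengths `b` and entries `t` of a tableau. The set `pred i`
consists of columns which are shorter and carry a smaller entry than `i`; a column is linked to at
most one longer one. The links encode the embedding `Linking.emb`, whose tableau has the entries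
`t`. -/
structure Linking {κ : Type*} (b t : κ → ℕ) where
  pred : κ → Finset κ
  length_lt : ∀ i, ∀ j ∈ pred i, b j < b i
  level_lt : ∀ i, ∀ j ∈ pred i, t j < t i
  succ_unique : ∀ i i' j, j ∈ pred i → j ∈ pred i' → i = i'
  exists_pred : ∀ i, 2 ≤ t i → ∃ j ∈ pred i, t j + 1 = t i
  length_pos : ∀ i, 1 ≤ t i → 1 ≤ b i

namespace Linking

variable {κ : Type*} {b t : κ → ℕ} (L : Linking b t) (R : Type*) [CommRing R]

/-- The relations `f_i = ∑ X^(b_i - b_j - 1) f_j` (`j ∈ pred i`) imposed at the columns with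
entry `> e`, together with `f_i = 0` at the other ones. They are to hold modulo `X^(b_i - 1)` and
`X^(b_i)`, respectively. -/
noncomputable def relation (e : ℕ) : (κ → R[X]) →ₗ[R[X]] κ → R[X] :=
  LinearMap.pi fun i => LinearMap.proj i -
    if e < t i then ∑ j ∈ L.pred i, (X : R[X]) ^ (b i - b j - 1) • LinearMap.proj j else 0

/-- The lengths of the columns of the `e`-th partition of the tableau with entries `t`. -/
def stageLength (b t : κ → ℕ) (e : ℕ) (i : κ) : ℕ :=
  if e < t i then b i - 1 else b i

/-- The submodule of `∏ R[X]/(X^(b_i))` cut out by the relations of level `e`; it is `p^e A` for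
the submodule `A` of level `0`. -/
noncomputable def submodule (e : ℕ) : Submodule R[X] (∀ i, TruncPoly R (b i)) :=
  (LinearMap.ker (mkPi (stageLength b t e) ∘ₗ L.relation R e)).map (mkPi b)

variable {R} {e : ℕ} {f g : κ → R[X]} {i : κ}

theorem relation_of_le (h : t i ≤ e) : L.relation R e f i = f i := by
  simp [relation, h.not_gt]

theorem relation_of_lt (h : e < t i) :
    L.relation R e f i = f i - ∑ j ∈ L.pred i, X ^ (b i - b j - 1) * f j := by
  simp [relation, h]

theorem stageLength_of_le (h : t i ≤ e) : stageLength b t e i = b i :=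
  if_neg h.not_gt

theorem stageLength_of_lt (h : e < t i) : stageLength b t e i = b i - 1 :=
  if_pos h

theorem stageLength_le (e : ℕ) (i : κ) : stageLength b t e i ≤ b i := by
  unfold stageLength
  split_ifs
  exacts [Nat.sub_le _ _, le_rfl]

theorem pow_length_sub_one_dvd {j : κ} (hj : j ∈ L.pred i) {p : R[X]} (hp : X ^ b j ∣ p) :
    X ^ (b i - 1) ∣ X ^ (b i - b j - 1) * p := by
  have hlt := L.length_lt i j hj
  rw [show b i - 1 = b i - b j - 1 + b j by omega, pow_add]
  exact mul_dvd_mul_left _ hp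

theorem ker_mkPi_le (e : ℕ) : LinearMap.ker (mkPi (R := R) b) ≤
    LinearMap.ker (mkPi (stageLength b t e) ∘ₗ L.relation R e) := by
  intro f hf
  rw [mem_ker_mkPi] at hf
  rw [LinearMap.mem_ker, LinearMap.comp_apply, ← LinearMap.mem_ker, mem_ker_mkPi]
  intro i
  have hfi := (pow_dvd_pow X (stageLength_le (b := b) (t := t) e i)).trans (hf i)
  rcases le_or_gt (t i) e with h | h
  · rwa [L.relation_of_le h]
  · rw [L.relation_of_lt h]
    rw [stageLength_of_lt h] at hfi ⊢
    exact dvd_sub hfi (Finset.dvd_sum fun j hj => L.pow_length_sub_one_dvd hj (hf j))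

theorem comap_submodule (e : ℕ) : (L.submodule R e).comap (mkPi b) =
    LinearMap.ker (mkPi (stageLength b t e) ∘ₗ L.relation R e) := by
  rw [submodule, Submodule.comap_map_eq, sup_eq_left.2 (L.ker_mkPi_le e)]

theorem mkPi_mem_submodule :
    mkPi b f ∈ L.submodule R e ↔ ∀ i, X ^ stageLength b t e i ∣ L.relation R e f i := by
  rw [← Submodule.mem_comap, comap_submodule, LinearMap.mem_ker, LinearMap.comp_apply,
    ← LinearMap.mem_ker, mem_ker_mkPi]

variable (R) in
theorem relation_surjective (e : ℕ) : Function.Surjective (L.relation R e) := by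
  intro g
  let F : ∀ i, (∀ j, t j < t i → R[X]) → R[X] := fun i f =>
    g i + if e < t i then
      ∑ j ∈ (L.pred i).attach, X ^ (b i - b j - 1) * f j (L.level_lt i j j.2) else 0
  refine ⟨(measure t).wf.fix F, funext fun i => ?_⟩
  have hfix := (measure t).wf.fix_eq F i
  rcases le_or_gt (t i) e with h | h
  · rw [L.relation_of_le h, hfix]
    simp only [F, h.not_gt, if_false, add_zero]
  · rw [L.relation_of_lt h, hfix]
    simp only [F, h, if_true]
    rw [Finset.sum_attach (L.pred i) fun j => X ^ (b i - b j - 1) * (measure t).wf.fix F j,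
      add_sub_cancel_right]

variable (R) in
theorem nonempty_quotient_submodule_equiv (e : ℕ) :
    Nonempty (((∀ i, TruncPoly R (b i)) ⧸ L.submodule R e) ≃ₗ[R[X]]
      ∀ i, TruncPoly R (stageLength b t e i)) := by
  have hker : LinearMap.ker ((L.submodule R e).mkQ ∘ₗ mkPi b) =
      LinearMap.ker (mkPi (stageLength b t e) ∘ₗ L.relation R e) := by
    rw [LinearMap.ker_comp, Submodule.ker_mkQ, comap_submodule]
  exact ⟨(LinearMap.quotKerEquivOfSurjective ((L.submodule R e).mkQ ∘ₗ mkPi b)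
      ((Submodule.mkQ_surjective _).comp (mkPi_surjective b))).symm.trans <|
    (Submodule.quotEquivOfEq _ _ hker).trans <| LinearMap.quotKerEquivOfSurjective _
      ((mkPi_surjective _).comp (L.relation_surjective R e))⟩

theorem exists_sum_pred_eq {M : Type*} [AddCommMonoid M] (a : κ → M) {e : ℕ} (he : 1 ≤ e) :
    ∃ c : κ → M, (∀ j, t j < e → c j = 0) ∧ ∀ i, e < t i → ∑ j ∈ L.pred i, c j = a i := by
  classical
  have hex : ∀ i, ∃ j, e < t i → j ∈ L.pred i ∧ t j + 1 = t i := fun i => by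
    by_cases h : e < t i
    · exact (L.exists_pred i (by omega)).imp fun _ hj _ => hj
    · exact ⟨i, fun h' => absurd h' h⟩
  choose π hπ using hex
  refine ⟨fun j => if h : ∃ i, e < t i ∧ π i = j then a h.choose else 0, fun j hj => ?_,
    fun i hi => ?_⟩
  · refine dif_neg ?_
    rintro ⟨i, hi, rfl⟩
    have := (hπ i hi).2
    omega
  · have hsource : ∀ i', e < t i' → π i' ∈ L.pred i → i' = i := fun i' hi' hmem =>
      L.succ_unique _ _ _ (hπ i' hi').1 hmem
    rw [Finset.sum_eq_single_of_mem (π i) (hπ i hi).1 fun j hj hne => ?_]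
    · have h : ∃ i', e < t i' ∧ π i' = π i := ⟨i, hi, rfl⟩
      rw [dif_pos h, hsource _ h.choose_spec.1 (h.choose_spec.2.symm ▸ (hπ i hi).1)]
    · refine dif_neg ?_
      rintro ⟨i', hi', rfl⟩
      exact hne (congrArg π (hsource i' hi' hj))

theorem X_smul_mem_submodule_succ {y : ∀ i, TruncPoly R (b i)} (hy : y ∈ L.submodule R e) :
    (X : R[X]) • y ∈ L.submodule R (e + 1) := by
  obtain ⟨f, rfl⟩ := mkPi_surjective b y
  rw [mkPi_mem_submodule] at hy
  rw [← map_smul, mkPi_mem_submodule]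
  intro i
  have hi := hy i
  rcases lt_trichotomy (e + 1) (t i) with h | h | h
  · rw [map_smul, Pi.smul_apply, smul_eq_mul]
    rw [relation_of_lt L (by omega), stageLength_of_lt (by omega)] at hi
    rw [relation_of_lt L h, stageLength_of_lt h]
    exact hi.mul_left _
  · have hpred : X ^ (b i - 1) ∣ ∑ j ∈ L.pred i, X ^ (b i - b j - 1) * f j :=
      Finset.dvd_sum fun j hj => by
        have hlevel := L.level_lt i j hj
        have hfj := hy j
        rw [L.relation_of_le (by omega), stageLength_of_le (by omega)] at hfj
        exact L.pow_length_sub_one_dvd hj hfj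
    rw [L.relation_of_lt (by omega), stageLength_of_lt (by omega), dvd_sub_left hpred] at hi
    rw [L.relation_of_le h.ge, stageLength_of_le h.ge, Pi.smul_apply, smul_eq_mul,
      ← Nat.sub_add_cancel (L.length_pos i (by omega)), pow_succ']
    exact mul_dvd_mul_left _ hi
  · rw [L.relation_of_le (by omega), stageLength_of_le (by omega)] at hi
    rw [L.relation_of_le h.le, stageLength_of_le h.le]
    exact hi.mul_left _

theorem two_le_length (L : Linking b t) (hi : 2 ≤ t i) : 2 ≤ b i := by
  obtain ⟨j, hj, hlevel⟩ := L.exists_pred i hi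
  have := L.length_pos j (by omega)
  have := L.length_lt i j hj
  omega

theorem exists_mkPi_X_smul_eq {y : ∀ i, TruncPoly R (b i)} (hy : y ∈ L.submodule R (e + 1)) :
    ∃ h : κ → R[X], mkPi b ((X : R[X]) • h) = y ∧ (∀ i, t i ≤ e + 1 → h i = 0) ∧
      ∀ i, e + 1 < t i → X ^ (b i - 2) ∣ L.relation R (e + 1) h i := by
  obtain ⟨f₀, rfl⟩ := mkPi_surjective b y
  let f : κ → R[X] := fun i => if t i ≤ e + 1 then 0 else f₀ i
  have hf₀ : mkPi b f = mkPi b f₀ := mkPi_eq_mkPi.2 fun i => by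
    have hi := mkPi_mem_submodule L |>.1 hy i
    by_cases h : t i ≤ e + 1
    · rw [L.relation_of_le h, stageLength_of_le h] at hi
      simpa only [f, if_pos h, zero_sub, dvd_neg] using hi
    · simp only [f, if_neg h, sub_self, dvd_zero]
  rw [← hf₀, mkPi_mem_submodule] at hy
  -- By induction on the entry: the relations express `f i` modulo `X` by the terms in `pred i`.
  have hdvd : ∀ i, X ∣ f i := fun i => by
    induction hn : t i using Nat.strong_induction_on generalizing i with
    | _ n ih =>
      subst hn
      rcases le_or_gt (t i) (e + 1) with h | h
      · simp only [f, if_pos h, dvd_zero]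
      · have hi := hy i
        have hb := L.two_le_length (by omega : 2 ≤ t i)
        rw [L.relation_of_lt h, stageLength_of_lt h] at hi
        exact (dvd_sub_left (Finset.dvd_sum fun j hj =>
          (ih _ (L.level_lt i j hj) j rfl).mul_left _)).1 <|
            (dvd_pow_self X (by omega)).trans hi
  choose h hh using hdvd
  have hsmul : (X : R[X]) • h = f := funext fun i => (hh i).symm
  refine ⟨h, by rw [hsmul, hf₀], fun i hi => ?_, fun i hi => ?_⟩
  · refine isRegular_X.left ((hh i).symm.trans ?_)
    simp only [f, if_pos hi, mul_zero]
  · have hb := L.two_le_length (by omega : 2 ≤ t i)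
    have hrel := hy i
    rw [← hsmul, map_smul, stageLength_of_lt hi, show b i - 1 = b i - 2 + 1 by omega,
      pow_succ'] at hrel
    obtain ⟨a, ha⟩ := hrel
    exact ⟨a, isRegular_X.left (by simpa only [Pi.smul_apply, smul_eq_mul, mul_assoc] using ha)⟩

theorem sum_pred_pow_mul {c : κ → R[X]} (hc : ∀ j, t j = 0 → c j = 0) :
    ∑ j ∈ L.pred i, X ^ (b i - b j - 1) * (X ^ (b j - 1) * c j) =
      X ^ (b i - 2) * ∑ j ∈ L.pred i, c j := by
  rw [Finset.mul_sum]
  refine Finset.sum_congr rfl fun j hj => ?_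
  rcases Nat.eq_zero_or_pos (t j) with hlevel | hlevel
  · simp only [hc j hlevel, mul_zero]
  · have := L.length_pos j hlevel
    have := L.length_lt i j hj
    rw [← mul_assoc, ← pow_add, show b i - b j - 1 + (b j - 1) = b i - 2 by omega]

theorem exists_X_smul_eq {y : ∀ i, TruncPoly R (b i)} (hy : y ∈ L.submodule R (e + 1)) :
    ∃ x ∈ L.submodule R e, (X : R[X]) • x = y := by
  obtain ⟨h, rfl, hzero, hrel⟩ := L.exists_mkPi_X_smul_eq hy
  choose! a ha using hrel
  obtain ⟨c, hc, hsum⟩ := L.exists_sum_pred_eq a (Nat.le_add_left 1 e)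
  have hc' : ∀ j, t j ≤ e → c j = 0 := fun j hj => hc j (Nat.lt_succ_of_le hj)
  -- `h` satisfies the relations only modulo `X ^ (b i - 2)`; adding `r`, which is killed by `X`,
  -- repairs this.
  let r : κ → R[X] := fun j => X ^ (b j - 1) * c j
  refine ⟨mkPi b (h + r), L.mkPi_mem_submodule.2 fun i => ?_, ?_⟩
  · rcases le_or_gt (t i) e with hi | hi
    · rw [L.relation_of_le hi, Pi.add_apply, hzero i (by omega)]
      simp only [r, hc' i hi, mul_zero, add_zero, dvd_zero]
    have hri : X ^ (b i - 1) ∣ r i := dvd_mul_right _ _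
    rw [stageLength_of_lt hi, map_add, Pi.add_apply, L.relation_of_lt hi (f := r),
      L.sum_pred_pow_mul fun j hj => hc' j (hj.le.trans (Nat.zero_le e))]
    rcases eq_or_lt_of_le (Nat.succ_le_of_lt hi) with hi' | hi'
    · have hpred : ∀ j ∈ L.pred i, t j ≤ e := fun j hj => by
        have := L.level_lt i j hj
        omega
      rw [Finset.sum_eq_zero fun j hj => hc' j (hpred j hj), L.relation_of_lt hi,
        hzero i hi'.ge, Finset.sum_eq_zero fun j hj => by
          rw [hzero j ((hpred j hj).trans (Nat.le_succ e)), mul_zero]]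
      simpa using hri
    · rw [hsum i hi', L.relation_of_lt hi, ← L.relation_of_lt hi', ha i hi']
      simpa using hri
  · rw [← map_smul, smul_add, map_add, add_eq_left, ← LinearMap.mem_ker, mem_ker_mkPi]
    intro i
    rcases le_or_gt (t i) e with hi | hi
    · simp only [r, Pi.smul_apply, hc' i hi, mul_zero, smul_zero, dvd_zero]
    · have hpow : (X : R[X]) ^ b i = X * X ^ (b i - 1) := by
        rw [← pow_succ', Nat.sub_add_cancel (L.length_pos i (by omega))]
      exact ⟨c i, by simp only [r, Pi.smul_apply, smul_eq_mul, hpow, mul_assoc]⟩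

theorem submodule_zero_map_pow (e : ℕ) : (L.submodule R 0).map
    (LinearMap.lsmul R[X] _ ((X : R[X]) ^ e)) = L.submodule R e := by
  induction e with
  | zero => ext; simp
  | succ e ih =>
    have hcomp : LinearMap.lsmul R[X] (∀ i, TruncPoly R (b i)) (X ^ (e + 1)) =
        LinearMap.lsmul R[X] _ X ∘ₗ LinearMap.lsmul R[X] _ (X ^ e) := LinearMap.ext fun y => by
      simp only [LinearMap.comp_apply, LinearMap.lsmul_apply, pow_succ', mul_smul]
    rw [hcomp, Submodule.map_comp, ih]
    refine le_antisymm ?_ fun y hy => L.exists_X_smul_eq hy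
    rintro _ ⟨y, hy, rfl⟩
    exact L.X_smul_mem_submodule_succ hy

theorem relation_congr (hi : f i = g i) (hpred : ∀ j ∈ L.pred i, f j = g j) :
    L.relation R e f i = L.relation R e g i := by
  rcases le_or_gt (t i) e with h | h
  · rw [L.relation_of_le h, L.relation_of_le h, hi]
  · rw [L.relation_of_lt h, L.relation_of_lt h, hi,
      Finset.sum_congr rfl fun j hj => by rw [hpred j hj]]

theorem relation_indicator {S : Set κ} (hS : ∀ i, ∀ j ∈ L.pred i, i ∈ S ↔ j ∈ S) :
    L.relation R e (S.indicator f) = S.indicator (L.relation R e f) := by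
  ext1 i
  by_cases hi : i ∈ S
  · rw [Set.indicator_of_mem hi]
    refine L.relation_congr (Set.indicator_of_mem hi f) fun j hj => ?_
    exact Set.indicator_of_mem ((hS i j hj).1 hi) f
  · rw [Set.indicator_of_notMem hi, ← Pi.zero_apply (M := fun _ : κ => R[X]) i,
      ← map_zero (L.relation R e)]
    refine L.relation_congr (Set.indicator_of_notMem hi f) fun j hj => ?_
    exact Set.indicator_of_notMem (mt (hS i j hj).2 hi) f

theorem mkPi_indicator_mem_submodule {S : Set κ} (hS : ∀ i, ∀ j ∈ L.pred i, i ∈ S ↔ j ∈ S)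
    (hf : mkPi b f ∈ L.submodule R e) : mkPi b (S.indicator f) ∈ L.submodule R e := by
  rw [mkPi_mem_submodule] at hf ⊢
  rw [L.relation_indicator hS]
  intro i
  by_cases hi : i ∈ S
  · rw [Set.indicator_of_mem hi]
    exact hf i
  · rw [Set.indicator_of_notMem hi]
    exact dvd_zero _

/-- The columns from which `m` is reached along links. If `m` itself is not linked to a longer
column, this is a connected component of the forest of links. -/
def component (m : κ) : Set κ :=
  {j | Relation.ReflTransGen (fun j i => j ∈ L.pred i) j m}

theorem mem_component_iff_of_mem_pred {m : κ} (hm : ∀ i, m ∉ L.pred i) {j : κ} (hj : j ∈ L.pred i) :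
    i ∈ L.component m ↔ j ∈ L.component m := by
  refine ⟨fun h => h.head hj, fun h => ?_⟩
  rcases h.cases_head with rfl | ⟨i', hi', h⟩
  · exact absurd hj (hm i)
  · rwa [L.succ_unique i i' j hj hi']

theorem notMem_component {m l : κ} (hl : ∀ i, l ∉ L.pred i) (hlm : l ≠ m) : l ∉ L.component m := by
  intro h
  rcases h.cases_head with rfl | ⟨i, hi, -⟩
  exacts [hlm rfl, hl i hi]

section Attach

variable [DecidableEq κ] {m l : κ}

theorem mem_update_insert_pred {i j : κ} :
    j ∈ Function.update L.pred m (insert l (L.pred m)) i ↔ i = m ∧ j = l ∨ j ∈ L.pred i := by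
  rcases eq_or_ne i m with rfl | hi
  · rw [Function.update_self, Finset.mem_insert]
    simp only [true_and]
  · rw [Function.update_of_ne hi]
    simp only [hi, false_and, false_or]

/-- The linking with an additional link from `l` to `m` and the entry of `m` increased to
`t l + 1`, for two roots `l` and `m` of the forest of links. -/
def attach (hm : ∀ i, m ∉ L.pred i) (hl : ∀ i, l ∉ L.pred i) (hb : b l < b m) (ht : t m ≤ t l) :
    Linking b (Function.update t m (t l + 1)) where
  pred := Function.update L.pred m (insert l (L.pred m))
  length_lt i j hj := by
    rcases L.mem_update_insert_pred.1 hj with ⟨rfl, rfl⟩ | hj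
    exacts [hb, L.length_lt i j hj]
  level_lt i j hj := by
    rcases L.mem_update_insert_pred.1 hj with ⟨rfl, rfl⟩ | hj
    · rw [Function.update_self, Function.update_of_ne (ne_of_apply_ne b hb.ne)]
      exact Nat.lt_succ_self _
    · rw [Function.update_of_ne (ne_of_mem_of_not_mem hj (hm i))]
      have hle : t ≤ Function.update t m (t l + 1) :=
        le_update_iff.2 ⟨ht.trans (Nat.le_succ _), fun _ _ => le_rfl⟩
      exact (L.level_lt i j hj).trans_le (hle i)
  succ_unique i i' j := by
    rw [L.mem_update_insert_pred, L.mem_update_insert_pred]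
    rintro (⟨rfl, rfl⟩ | h) (⟨rfl, h'⟩ | h')
    exacts [rfl, absurd h' (hl i'), absurd (h' ▸ h) (hl i), L.succ_unique i i' j h h']
  exists_pred i hi := by
    rcases eq_or_ne i m with rfl | him
    · refine ⟨l, L.mem_update_insert_pred.2 (Or.inl ⟨rfl, rfl⟩), ?_⟩
      rw [Function.update_self, Function.update_of_ne (ne_of_apply_ne b hb.ne)]
    · rw [Function.update_of_ne him] at hi
      obtain ⟨j, hj, hlevel⟩ := L.exists_pred i hi
      refine ⟨j, L.mem_update_insert_pred.2 (Or.inr hj), ?_⟩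
      rwa [Function.update_of_ne him, Function.update_of_ne (ne_of_mem_of_not_mem hj (hm i))]
  length_pos i hi := by
    rcases eq_or_ne i m with rfl | him
    · exact Nat.one_le_of_lt hb
    · rw [Function.update_of_ne him] at hi
      exact L.length_pos i hi

theorem relation_single (hm : ∀ i, m ∉ L.pred i) (p : R[X]) :
    L.relation R e (Pi.single m p) = Pi.single m p := by
  ext1 i
  rcases le_or_gt (t i) e with h | h
  · rw [L.relation_of_le h]
  · rw [L.relation_of_lt h, Finset.sum_eq_zero fun j hj => ?_, sub_zero]
    rw [Pi.single_eq_of_ne (ne_of_mem_of_not_mem hj (hm i)), mul_zero]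

theorem relation_attach (hm : ∀ i, m ∉ L.pred i) (hl : ∀ i, l ∉ L.pred i) (hb : b l < b m)
    (ht : t m ≤ t l) (he : e < t m) : (L.attach hm hl hb ht).relation R e f =
      L.relation R e (f - Pi.single m (X ^ (b m - b l - 1) * f l)) := by
  rw [map_sub, L.relation_single hm]
  ext1 i
  rcases eq_or_ne i m with rfl | hi
  · rw [relation_of_lt _ (by rw [Function.update_self]; omega), Pi.sub_apply, Pi.single_eq_same,
      L.relation_of_lt he]
    simp only [attach, Function.update_self]
    rw [Finset.sum_insert (hl i)]
    ring
  · rw [Pi.sub_apply, Pi.single_eq_of_ne hi, sub_zero]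
    rcases le_or_gt (t i) e with h | h
    · rw [L.relation_of_le h, relation_of_le _ (by rwa [Function.update_of_ne hi])]
    · rw [L.relation_of_lt h, relation_of_lt _ (by rwa [Function.update_of_ne hi])]
      simp only [attach, Function.update_of_ne hi]

theorem mkPi_mem_submodule_attach (hm : ∀ i, m ∉ L.pred i) (hl : ∀ i, l ∉ L.pred i)
    (hb : b l < b m) (ht : t m ≤ t l) (he : e < t m) :
    mkPi b f ∈ (L.attach hm hl hb ht).submodule R e ↔
      mkPi b (f - Pi.single m (X ^ (b m - b l - 1) * f l)) ∈ L.submodule R e := by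
  have hlength : stageLength b (Function.update t m (t l + 1)) e = stageLength b t e := by
    ext1 i
    rcases eq_or_ne i m with rfl | hi
    · rw [stageLength_of_lt he, stageLength_of_lt (by rw [Function.update_self]; omega)]
    · simp only [stageLength, Function.update_of_ne hi]
  rw [mkPi_mem_submodule, mkPi_mem_submodule, L.relation_attach hm hl hb ht he, hlength]

theorem mkPi_mem_range_sup_submodule_attach (hm : ∀ i, m ∉ L.pred i) (hl : ∀ i, l ∉ L.pred i)
    (hb : b l < b m) (ht : t m ≤ t l) (he : e < t m) :
    mkPi b f ∈ LinearMap.range (coordProj R b (L.component m)) ⊔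
        (L.attach hm hl hb ht).submodule R e ↔
      mkPi b (f - (L.component m).indicator f) ∈ L.submodule R e := by
  have hlm : l ≠ m := fun h => hb.ne (congrArg b h)
  have hlS := L.notMem_component hl hlm
  have hmS : m ∈ L.component m := Relation.ReflTransGen.refl
  set S := L.component m
  have hsingle : ∀ p : R[X], S.indicator (Pi.single m p) = (Pi.single m p : κ → R[X]) := fun p =>
    Set.indicator_eq_self.2 (Pi.support_single_subset.trans (Set.singleton_subset_iff.2 hmS))
  rw [Submodule.mem_sup]
  constructor
  · rintro ⟨_, ⟨x, rfl⟩, a, ha, hsum⟩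
    obtain ⟨f', rfl⟩ := mkPi_surjective b x
    obtain ⟨g, rfl⟩ := mkPi_surjective b a
    rw [L.mkPi_mem_submodule_attach hm hl hb ht he] at ha
    have hcompl := sub_mem ha
      (L.mkPi_indicator_mem_submodule (fun _ _ hj => L.mem_component_iff_of_mem_pred hm hj) ha)
    rw [← map_sub, Set.indicator_sub', hsingle, sub_sub_sub_cancel_right] at hcompl
    rw [map_sub, ← coordProj_mkPi, ← hsum, map_add, coordProj_mkPi, coordProj_mkPi, coordProj_mkPi,
      Set.indicator_indicator, Set.inter_self, add_sub_add_left_eq_sub, ← map_sub]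
    exact hcompl
  · intro hf
    let s : κ → R[X] := Pi.single m (X ^ (b m - b l - 1) * f l)
    refine ⟨_, ⟨mkPi b (f - s), rfl⟩, mkPi b (f - S.indicator f + s), ?_, ?_⟩
    · rw [L.mkPi_mem_submodule_attach hm hl hb ht he, Pi.add_apply, Pi.sub_apply,
        Set.indicator_of_notMem hlS, sub_zero, show s l = 0 from Pi.single_eq_of_ne hlm _, add_zero,
        add_sub_cancel_right]
      exact hf
    · rw [coordProj_mkPi, ← map_add, Set.indicator_sub', hsingle]
      congr 1
      abel

/-- The link from `l` to `m` is the only one between the component of `m` and its complement;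
splitting off the component cuts it. -/
theorem comap_inf_sup_submodule_attach (hm : ∀ i, m ∉ L.pred i) (hl : ∀ i, l ∉ L.pred i)
    (hb : b l < b m) (ht : t m ≤ t l) (he : e < t m) :
    ((L.attach hm hl hb ht).submodule R e).comap (coordProj R b (L.component m)) ⊓
      (LinearMap.range (coordProj R b (L.component m)) ⊔ (L.attach hm hl hb ht).submodule R e) =
        L.submodule R e := by
  have hlS := L.notMem_component hl fun h => hb.ne (congrArg b h)
  ext y
  obtain ⟨f, rfl⟩ := mkPi_surjective b y
  rw [Submodule.mem_inf, Submodule.mem_comap, coordProj_mkPi,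
    L.mkPi_mem_submodule_attach hm hl hb ht he, Set.indicator_of_notMem hlS, mul_zero,
    Pi.single_zero, sub_zero, L.mkPi_mem_range_sup_submodule_attach hm hl hb ht he]
  refine ⟨fun ⟨h₁, h₂⟩ => ?_, fun h => ?_⟩
  · have hadd := add_mem h₁ h₂
    rwa [← map_add, add_sub_cancel] at hadd
  · have hind := L.mkPi_indicator_mem_submodule
      (fun _ _ hj => L.mem_component_iff_of_mem_pred hm hj) h
    exact ⟨hind, by rw [map_sub]; exact sub_mem h hind⟩

end Attach

end Linking

namespace Linking

variable {κ : Type} [Fintype κ] {b t : κ → ℕ} (L : Linking b t) (k : Type u) [Field k]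

/-- The embedding of the submodule cut out by the links into `∏ k[X]/(X^(b_i))`. -/
noncomputable def emb : Emb k where
  B := ∀ i, TruncPoly k (b i)
  nilpotent := by
    refine ⟨Finset.univ.sup b, fun y => ?_⟩
    obtain ⟨f, rfl⟩ := mkPi_surjective b y
    rw [← map_smul, ← LinearMap.mem_ker, mem_ker_mkPi]
    exact fun i => (pow_dvd_pow X (Finset.le_sup (Finset.mem_univ i))).mul_right _
  A := L.submodule k 0

theorem powA_emb (e : ℕ) : (L.emb k).powA e = L.submodule k e :=
  L.submodule_zero_map_pow e

theorem extLE_attach [DecidableEq κ] {m l : κ} (hm : ∀ i, m ∉ L.pred i) (hl : ∀ i, l ∉ L.pred i)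
    (hb : b l < b m) (ht : t m ≤ t l) (hpos : 0 < t m) :
    Emb.ExtLE ((L.attach hm hl hb ht).emb k) (L.emb k) :=
  Emb.extLE_withSub ((L.attach hm hl hb ht).emb k) (isProj_coordProj b (L.component m))
    (L.comap_inf_sup_submodule_attach hm hl hb ht hpos)

end Linking

/-- The map `π` matches the columns with entry `e + 1` injectively with shorter columns with
entry `e`; `b` and `t` are the lengths and the entries of the columns. -/
structure IsLevelMatching {κ : Type*} (b t : κ → ℕ) (e : ℕ) (π : κ → κ) : Prop where
  level : ∀ i, t i = e + 1 → t (π i) = e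
  length_lt : ∀ i, t i = e + 1 → b (π i) < b i
  injOn : Set.InjOn π {i | t i = e + 1}

section Matching

variable {κ : Type*} {b t : κ → ℕ}

/-- The linking of each column with entry at least `2` to its match. -/
def Linking.ofMatchings (π : ℕ → κ → κ) (h : ∀ e, 1 ≤ e → IsLevelMatching b t e (π e))
    (hpos : ∀ i, 1 ≤ t i → 1 ≤ b i) : Linking b t where
  pred i := if 2 ≤ t i then {π (t i - 1) i} else ∅
  length_lt i j hj := by
    split_ifs at hj with hi
    · rw [Finset.mem_singleton.1 hj]
      exact (h (t i - 1) (by omega)).length_lt i (by omega)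
    · exact absurd hj (Finset.notMem_empty j)
  level_lt i j hj := by
    split_ifs at hj with hi
    · rw [Finset.mem_singleton.1 hj, (h (t i - 1) (by omega)).level i (by omega)]
      omega
    · exact absurd hj (Finset.notMem_empty j)
  succ_unique i i' j hj hj' := by
    split_ifs at hj hj' with hi hi'
    · rw [Finset.mem_singleton] at hj hj'
      have hlevel := (h (t i - 1) (by omega)).level i (by omega)
      have hlevel' := (h (t i' - 1) (by omega)).level i' (by omega)
      have htt : t i = t i' := by
        rw [← hj] at hlevel
        rw [← hj'] at hlevel'
        omega
      refine (h (t i - 1) (by omega)).injOn ?_ ?_ (hj.symm.trans (htt ▸ hj'))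
      · rw [Set.mem_ofPred_eq]
        omega
      · rw [Set.mem_ofPred_eq]
        omega
    all_goals simp_all only [Finset.notMem_empty]
  exists_pred i hi := by
    have hlevel := (h (t i - 1) (by omega)).level i (by omega)
    exact ⟨_, by rw [if_pos hi, Finset.mem_singleton], by omega⟩
  length_pos := hpos

theorem Linking.notMem_pred_ofMatchings {π : ℕ → κ → κ}
    (h : ∀ e, 1 ≤ e → IsLevelMatching b t e (π e)) (hpos : ∀ i, 1 ≤ t i → 1 ≤ b i) {j : κ}
    (hj : ∀ i, t i = t j + 1 → π (t j) i ≠ j) (i : κ) :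
    j ∉ (Linking.ofMatchings π h hpos).pred i := by
  intro hmem
  simp only [Linking.ofMatchings] at hmem
  split_ifs at hmem with hi
  · rw [Finset.mem_singleton] at hmem
    have hlevel := (h (t i - 1) (by omega)).level i (by omega)
    rw [← hmem] at hlevel
    exact hj i (by omega) (hlevel ▸ hmem.symm)
  · exact absurd hmem (Finset.notMem_empty j)

variable {t' : κ → ℕ} {m : κ}

theorem IsLevelMatching.congr_off {e : ℕ} {π : κ → κ} (h : IsLevelMatching b t' e π)
    (heq : ∀ i ≠ m, t' i = t i) (hle : t m ≤ e) (hlt : e < t' m) : IsLevelMatching b t e π := by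
  have hlevel : ∀ i, t i = e + 1 → t' i = e + 1 := fun i hi => by
    rwa [heq i fun him => by rw [him] at hi; omega]
  refine ⟨fun i hi => ?_, fun i hi => h.length_lt i (hlevel i hi), h.injOn.mono hlevel⟩
  have hπ := h.level i (hlevel i hi)
  rwa [heq _ fun him => by rw [him] at hπ; omega] at hπ

/-- When the entry `t m` is increased to `t' m`, the matchings for `t'` are used between these two
entries: there `m` is not needed as a match for `t`, and neither is the match of `m` for `t'`. -/
theorem Linking.exists_attachable (h : ∀ e, 1 ≤ e → ∃ π, IsLevelMatching b t e π)
    (h' : ∀ e, 1 ≤ e → ∃ π, IsLevelMatching b t' e π) (hpos : ∀ i, 1 ≤ t i → 1 ≤ b i)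
    (heq : ∀ i ≠ m, t' i = t i) (hm : 1 ≤ t m) (hlt : t m < t' m) :
    ∃ (L : Linking b t) (l : κ), (∀ i, m ∉ L.pred i) ∧ (∀ i, l ∉ L.pred i) ∧ b l < b m ∧
      t m ≤ t l ∧ t' m = t l + 1 := by
  have : Nonempty κ := ⟨m⟩
  choose! π hπ using h
  choose! π' hπ' using h'
  let ρ : ℕ → κ → κ := fun e => if t m ≤ e ∧ e < t' m then π' e else π e
  have hρ : ∀ e, t m ≤ e → e < t' m → ρ e = π' e := fun e he he' => if_pos ⟨he, he'⟩
  have hmatch : ∀ e, 1 ≤ e → IsLevelMatching b t e (ρ e) := fun e he => by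
    by_cases hc : t m ≤ e ∧ e < t' m
    · exact hρ e hc.1 hc.2 ▸ (hπ' e he).congr_off heq hc.1 hc.2
    · rw [show ρ e = π e from if_neg hc]
      exact hπ e he
  have hne : ∀ i, t m < t i → i ≠ m := fun i hi him => hi.ne' (congrArg t him)
  obtain ⟨e, he⟩ : ∃ e, t' m = e + 1 := Nat.exists_eq_succ_of_ne_zero (by omega)
  have hl' : t' (π' e m) = e := (hπ' e (by omega)).level m he
  have hlm : π' e m ≠ m := fun hlm => by
    rw [hlm] at hl'
    omega
  have hl : t (π' e m) = e := heq _ hlm ▸ hl'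
  refine ⟨Linking.ofMatchings ρ hmatch hpos, π' e m,
    Linking.notMem_pred_ofMatchings hmatch hpos fun i hi hρi => ?_,
    Linking.notMem_pred_ofMatchings hmatch hpos fun i hi hρi => ?_,
    (hπ' e (by omega)).length_lt m he, by omega, by omega⟩
  · rw [hρ _ le_rfl hlt] at hρi
    have hlevel := (hπ' (t m) hm).level i (by rw [heq i (hne i (by omega)), hi])
    rw [hρi] at hlevel
    omega
  · rw [hl, hρ e (by omega) (by omega)] at hρi
    rw [hl] at hi
    refine hne i (by omega) ((hπ' e (by omega)).injOn ?_ he hρi)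
    rw [Set.mem_ofPred_eq, heq i (hne i (by omega)), hi]

end Matching

theorem exists_injOn_mem_le {α : Type*} [LinearOrder α] {P Q : Finset α}
    (h : ∀ c, (Q.filter (c ≤ ·)).card ≤ (P.filter (c ≤ ·)).card) :
    ∃ f : α → α, Set.InjOn f Q ∧ ∀ j ∈ Q, f j ∈ P ∧ j ≤ f j := by
  obtain ⟨f, hf, hfmem⟩ := (Finset.all_card_le_biUnion_card_iff_exists_injective
    (fun j : Q => P.filter (j.1 ≤ ·))).1 <| by
      intro s
      rcases s.eq_empty_or_nonempty with rfl | hs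
      · simp
      · set c := s.min' hs
        calc s.card = (s.map (Function.Embedding.subtype _)).card := (Finset.card_map _).symm
          _ ≤ (Q.filter (c.1 ≤ ·)).card := by
            refine Finset.card_le_card fun j hj => ?_
            obtain ⟨i, hi, rfl⟩ := Finset.mem_map.1 hj
            exact Finset.mem_filter.2 ⟨i.2, s.min'_le i hi⟩
          _ ≤ (P.filter (c.1 ≤ ·)).card := h c.1
          _ ≤ _ := Finset.card_le_card
            (Finset.subset_biUnion_of_mem (fun j : Q => P.filter (j.1 ≤ ·)) (s.min'_mem hs))
  refine ⟨fun j => if hj : j ∈ Q then f ⟨j, hj⟩ else j, fun i hi j hj hij => ?_, fun j hj => ?_⟩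
  · have hi' : i ∈ Q := hi
    have hj' : j ∈ Q := hj
    simp only [dif_pos hi', dif_pos hj'] at hij
    exact congrArg Subtype.val (hf hij)
  · simp only [dif_pos hj]
    exact Finset.mem_filter.1 (hfmem ⟨j, hj⟩)

namespace LRTableau

variable {β γ : YoungDiagram} {Γ Δ : LRTableau β γ}

/-- The entry in the cell just below the column `j` of `γ`. On a rook strip, this is the only
entry of the column, or `0` if the column has no cell in `β \ γ`. -/
def colEntry (Γ : LRTableau β γ) (j : ℕ) : ℕ := Γ.entry (γ.colLen j) j

theorem mem_of_entry_ne_zero {i j : ℕ} (h : Γ.entry i j ≠ 0) : (i, j) ∈ β ∧ (i, j) ∉ γ := by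
  contrapose! h
  exact Γ.zero i j (or_iff_not_imp_left.2 fun hβ => h (not_not.1 hβ))

theorem colLen_of_colEntry_ne_zero (hrook : IsRookStrip β γ) {j : ℕ} (h : Γ.colEntry j ≠ 0) :
    β.colLen j = γ.colLen j + 1 :=
  (hrook.2.1 j).antisymm (YoungDiagram.mem_iff_lt_colLen.1 (mem_of_entry_ne_zero h).1)

theorem one_le_colLen_of_colEntry {j : ℕ} (h : 1 ≤ Γ.colEntry j) : 1 ≤ β.colLen j :=
  Nat.one_le_of_lt
    (YoungDiagram.mem_iff_lt_colLen.1 (mem_of_entry_ne_zero (Nat.ne_zero_of_lt h)).1)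

theorem eq_colLen_of_entry_ne_zero (hrook : IsRookStrip β γ) {i j : ℕ} (h : Γ.entry i j ≠ 0) :
    i = γ.colLen j := by
  obtain ⟨hβ, hγ⟩ := mem_of_entry_ne_zero h
  rw [YoungDiagram.mem_iff_lt_colLen] at hβ hγ
  have := hrook.2.1 j
  omega

theorem lt_rowLen_zero_of_entry_ne_zero {i j : ℕ} (h : Γ.entry i j ≠ 0) : j < β.rowLen 0 :=
  YoungDiagram.mem_iff_lt_rowLen.1
    (β.up_left_mem (Nat.zero_le i) le_rfl (mem_of_entry_ne_zero h).1)

theorem colLen_lt_colLen (hrook : IsRookStrip β γ) {j j' : ℕ} (hjj' : j < j')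
    (h : Γ.colEntry j ≠ 0) (h' : Γ.colEntry j' ≠ 0) : β.colLen j' < β.colLen j := by
  refine lt_of_le_of_ne (β.colLen_anti _ _ hjj'.le) fun hlen => ?_
  have hrow : γ.colLen j' = γ.colLen j := by
    have := colLen_of_colEntry_ne_zero hrook h
    have := colLen_of_colEntry_ne_zero hrook h'
    omega
  have hβ := (mem_of_entry_ne_zero h').1
  have hγ := (mem_of_entry_ne_zero h).2
  rw [hrow, YoungDiagram.mem_iff_lt_rowLen] at hβ
  rw [YoungDiagram.mem_iff_lt_rowLen] at hγ
  have := hrook.2.2 (γ.colLen j)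
  omega

theorem card_filter_entry (hrook : IsRookStrip β γ) (c : ℕ) {e : ℕ} (he : e ≠ 0) :
    (β.cells.filter fun x => c ≤ x.2 ∧ Γ.entry x.1 x.2 = e).card =
      (Finset.univ.filter fun j : Fin (β.rowLen 0) => c ≤ j ∧ Γ.colEntry j = e).card := by
  symm
  refine Finset.card_bij (fun j _ => (γ.colLen j, (j : ℕ))) (fun j hj => ?_)
    (fun i _ j _ hij => Fin.ext (congrArg Prod.snd hij)) ?_
  · obtain ⟨hc, hentry⟩ := (Finset.mem_filter.1 hj).2
    exact Finset.mem_filter.2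
      ⟨(YoungDiagram.mem_cells _).2 (mem_of_entry_ne_zero (hentry ▸ he)).1, hc, hentry⟩
  · rintro ⟨i, j⟩ hx
    obtain ⟨-, hc, hentry⟩ := Finset.mem_filter.1 hx
    dsimp only at hc hentry
    have hne : Γ.entry i j ≠ 0 := hentry ▸ he
    obtain rfl := eq_colLen_of_entry_ne_zero hrook hne
    exact ⟨⟨j, lt_rowLen_zero_of_entry_ne_zero hne⟩,
      Finset.mem_filter.2 ⟨Finset.mem_univ _, hc, hentry⟩, rfl⟩

theorem exists_isLevelMatching (hrook : IsRookStrip β γ) (Γ : LRTableau β γ) {e : ℕ}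
    (he : 1 ≤ e) : ∃ π, IsLevelMatching (fun j : Fin (β.rowLen 0) => β.colLen j)
      (fun j => Γ.colEntry j) e π := by
  obtain ⟨π, hinj, hπ⟩ := exists_injOn_mem_le
    (P := Finset.univ.filter fun j : Fin (β.rowLen 0) => Γ.colEntry j = e)
    (Q := Finset.univ.filter fun j : Fin (β.rowLen 0) => Γ.colEntry j = e + 1) <| by
      intro c
      have hcard := Γ.lattice c e he
      rw [card_filter_entry hrook _ (by omega), card_filter_entry hrook _ (by omega)] at hcard
      simpa only [Finset.filter_filter, and_comm, Fin.le_def] using hcard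
  simp only [Finset.coe_filter, Finset.mem_filter, Finset.mem_univ, true_and] at hinj hπ
  refine ⟨π, fun j hj => (hπ j hj).1, fun j hj => ?_, hinj⟩
  obtain ⟨hlevel, hle⟩ := hπ j hj
  refine colLen_lt_colLen (Γ := Γ) hrook (lt_of_le_of_ne hle fun h => ?_) (by omega) (by omega)
  rw [← h] at hlevel
  omega

theorem IncreasesEntry.exists_column (hrook : IsRookStrip β γ) (h : Δ.IncreasesEntry Γ) :
    ∃ m : Fin (β.rowLen 0), 1 ≤ Γ.colEntry m ∧ Γ.colEntry m < Δ.colEntry m ∧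
      ∀ j ≠ m, Δ.colEntry j = Γ.colEntry j := by
  obtain ⟨i, j, hβ, hγ, hlt, hother⟩ := h
  have hpos := Γ.pos i j hβ hγ
  obtain rfl := eq_colLen_of_entry_ne_zero hrook (Nat.ne_zero_of_lt hpos)
  exact ⟨⟨j, lt_rowLen_zero_of_entry_ne_zero (Nat.ne_zero_of_lt hpos)⟩, hpos, hlt,
    fun l hl => hother _ _ fun hlj => hl (Fin.ext (congrArg Prod.snd hlj))⟩

theorem mem_stage {e i j : ℕ} : (i, j) ∈ Γ.stage e ↔ (i, j) ∈ β ∧ Γ.entry i j ≤ e := by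
  rw [← YoungDiagram.mem_cells, stage, Finset.mem_filter, YoungDiagram.mem_cells]

theorem stage_zero : Γ.stage 0 = γ := by
  ext ⟨i, j⟩
  rw [YoungDiagram.mem_cells, YoungDiagram.mem_cells, mem_stage]
  refine ⟨fun ⟨hβ, hentry⟩ => ?_, fun h => ⟨Γ.le h, (Γ.zero i j (Or.inr h)).le⟩⟩
  by_contra hγ
  exact (Γ.pos i j hβ hγ).not_gt (Nat.lt_succ_of_le hentry)

theorem colLen_stage (hrook : IsRookStrip β γ) (e j : ℕ) :
    (Γ.stage e).colLen j = if e < Γ.colEntry j then β.colLen j - 1 else β.colLen j := by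
  refine eq_of_forall_lt_iff fun i => ?_
  rw [← YoungDiagram.mem_iff_lt_colLen, mem_stage, YoungDiagram.mem_iff_lt_colLen]
  by_cases hentry : Γ.entry i j = 0
  · have hne : Γ.colEntry j ≠ 0 → i ≠ γ.colLen j := by
      rintro h rfl
      exact h hentry
    split_ifs with h
    · have := colLen_of_colEntry_ne_zero hrook (Nat.ne_zero_of_lt h)
      have := hne (Nat.ne_zero_of_lt h)
      omega
    · omega
  · obtain rfl := eq_colLen_of_entry_ne_zero hrook hentry
    have hlen := colLen_of_colEntry_ne_zero hrook hentry
    change _ ∧ Γ.colEntry j ≤ e ↔ _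
    split_ifs with h <;> omega

theorem rowLen_stage_le (e i : ℕ) : (Γ.stage e).rowLen i ≤ β.rowLen i :=
  le_of_forall_lt fun j hj => by
    rw [← YoungDiagram.mem_iff_lt_rowLen] at hj ⊢
    exact (mem_stage.1 hj).1

end LRTableau

theorem nonempty_pi_truncPoly_equiv_N (k : Type u) [Field k] {α : YoungDiagram} {n : ℕ}
    (hn : α.rowLen 0 ≤ n) : Nonempty (((j : Fin n) → TruncPoly k (α.colLen j)) ≃ₗ[k[X]] N k α) := by
  let φ : ((j : Fin n) → TruncPoly k (α.colLen j)) →ₗ[k[X]] N k α :=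
    LinearMap.pi fun j => LinearMap.proj (Fin.castLE hn j)
  have hzero : ∀ j : Fin n, ∀ x : TruncPoly k (α.colLen j), α.rowLen 0 ≤ j → x = 0 := by
    intro j x hj
    obtain ⟨f, rfl⟩ := Ideal.Quotient.mk_surjective x
    have hlen : α.colLen j = 0 := Nat.eq_zero_of_not_pos fun h => hj.not_gt <|
      YoungDiagram.mem_iff_lt_rowLen.1 (YoungDiagram.mem_iff_lt_colLen.2 h)
    rw [Ideal.Quotient.eq_zero_iff_dvd, hlen, pow_zero]
    exact one_dvd f
  refine ⟨LinearEquiv.ofBijective φ ⟨?_, fun z => ?_⟩⟩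
  · refine (injective_iff_map_eq_zero φ).2 fun y hy => funext fun j => ?_
    rcases lt_or_ge (j : ℕ) (α.rowLen 0) with hj | hj
    · exact congrFun hy ⟨j, hj⟩
    · exact hzero j _ hj
  · exact ⟨fun j => if hj : (j : ℕ) < α.rowLen 0 then z ⟨j, hj⟩ else 0,
      funext fun j => dif_pos j.2⟩

section Realization

variable {k : Type u} [Field k] {β γ : YoungDiagram} {Γ Δ : LRTableau β γ}
  {t : Fin (β.rowLen 0) → ℕ} {L : Linking (fun j : Fin (β.rowLen 0) => β.colLen j) t}

theorem Linking.hasTableau_emb (hrook : IsRookStrip β γ)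
    (ht : (fun j : Fin (β.rowLen 0) => Γ.colEntry j) = t) : (L.emb k).HasTableau Γ := by
  subst ht
  intro e
  obtain ⟨φ⟩ := L.nonempty_quotient_submodule_equiv k e
  obtain ⟨ψ⟩ := nonempty_pi_truncPoly_equiv_N k (LRTableau.rowLen_stage_le (Γ := Γ) e 0)
  have hlen : Linking.stageLength (fun j : Fin (β.rowLen 0) => β.colLen j)
      (fun j => Γ.colEntry j) e = fun j : Fin (β.rowLen 0) => (Γ.stage e).colLen j :=
    funext fun j => by rw [LRTableau.colLen_stage hrook, stageLength]
  rw [hlen] at φ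
  rw [L.powA_emb]
  exact ⟨φ.trans ψ⟩

theorem Linking.hasType_emb (h : (L.emb k).HasTableau Γ) : (L.emb k).HasType β γ := by
  refine ⟨⟨LinearEquiv.refl _ _⟩, ?_⟩
  have hzero := h 0
  rwa [LRTableau.stage_zero, L.powA_emb] at hzero

theorem LRTableau.extLE_of_emb {U V : Emb k} (hU : U.HasType β γ) (hV : V.HasType β γ)
    (hΔ : U.HasTableau Δ) (hΓ : V.HasTableau Γ) (h : Emb.ExtLE U V) :
    LRTableau.ExtLE k Δ Γ :=
  ⟨1, fun i => if i = 0 then Δ else Γ, rfl, rfl, fun i hi => by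
    obtain rfl : i = 0 := Nat.lt_one_iff.1 hi
    exact ⟨U, V, hU, hV, hΔ, hΓ, h⟩⟩

end Realization

end RookStrip

theorem mainTheorem5 (k : Type*) [Field k] (β γ : YoungDiagram)
    (hrook : RookStrip.IsRookStrip β γ) (Δ Γ : RookStrip.LRTableau β γ)
    (h : Δ.IncreasesEntry Γ) : RookStrip.LRTableau.ExtLE k Δ Γ := by
  obtain ⟨m, hm, hlt, hother⟩ := h.exists_column hrook
  obtain ⟨L, l, hmL, hlL, hb, hle, hml⟩ := RookStrip.Linking.exists_attachable
    (fun _ => Γ.exists_isLevelMatching hrook) (fun _ => Δ.exists_isLevelMatching hrook)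
    (fun _ => RookStrip.LRTableau.one_le_colLen_of_colEntry) hother hm hlt
  have hupdate : (fun j : Fin (β.rowLen 0) => Δ.colEntry j) =
      Function.update (fun j : Fin (β.rowLen 0) => Γ.colEntry j) m (Γ.colEntry l + 1) :=
    Function.eq_update_iff.2 ⟨hml, hother⟩
  have hΔ := (L.attach hmL hlL hb hle).hasTableau_emb (k := k) hrook hupdate
  have hΓ := L.hasTableau_emb (k := k) (Γ := Γ) hrook rfl
  exact RookStrip.LRTableau.extLE_of_emb (RookStrip.Linking.hasType_emb hΔ)
    (RookStrip.Linking.hasType_emb hΓ) hΔ hΓ (L.extLE_attach k hmL hlL hb hle hm)
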